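/- Let $m\ge 1$ and consider the scalar linear equation with several delays $$\dot x(t)+a(t)x(t)+\sum_{k=1}^m b_k(t)\,x(h_k(t))=0,\qquad t\ge 0, \tag{1}$$ where $a,b_1,\dots,b_m$ are Lebesgue measurable, essentially bounded, nonnegative functions on $[0,\infty)$, and $h_1,\dots,h_m$ are Lebesgue measurable real-valued functions with $h_k(t)\le t$ for $t\ge 0$ and $\lim_{t\to\infty}h_k(t)=\infty$. For $t_0\ge 0$ and a bounded Borel measurable initial function $\varphi$ on $(-\infty,t_0]$, a solution of (1) with initial point $t_0$ is a function $x$ that is locally absolutely continuous on $[t_0,\infty)$, satisfies (1) for almost every $t\ge t_0$, and satisfies $x(t)=\varphi(t)$ for $t\le t_0$. Equation (1) is called exponentially stable if there are $M>0$ and $\alpha>0$, independent of $t_0$ and $\varphi$, such that every such solution satisfies $$|x(t)|\le M\Big(\sup_{s\le t_0}|\varphi(s)|\Big)e^{-\alpha(t-t_0)},\qquad t\ge t_0 .$$ Theorem 3. Suppose that $a(t)\ge a_0>0$ for some constant $a_0$ and all $t\ge 0$, that $b_k(t)\ge 0$ for all $k$ and $t\ge0$, and that $$h_0:=\limsup_{t\to\infty}\int_{\min_k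 h_k(t)}^t a(s)\,ds<\infty .$$ Put $b(t)=\sum_{k=1}^m b_k(t)$ and $\beta:=\limsup_{t\to\infty}\dfrac{b(t)}{a(t)}$, and assume that $\beta<\infty$. If $$\frac1\beta\,e^{-h_0}>\ln\frac{\beta^2+\beta}{\beta^2+1}$$ (for $\beta=0$ this inequality is regarded as satisfied), then equation (1) is exponentially stable. -/

import Mathlib

/-- The smallest of finitely many delayed arguments, `min_k h_k(t)`. -/
noncomputable def minDelay {m : ℕ} [NeZero m] (h : Fin m → ℝ → ℝ) (t : ℝ) : ℝ :=
  Finset.univ.inf' Finset.univ_nonempty (fun k => h k t)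

/-- `x` solves `x'(t) + a(t) x(t) + ∑ₖ bₖ(t) x(hₖ(t)) = 0` for `t ≥ t₀` with `x = φ` on `(-∞, t₀]`:
`x` is (locally) absolutely continuous on `[t₀, ∞)`, the equation holds at almost every `t ≥ t₀`,
and `x` agrees with `φ` up to and including the initial point. -/
structure IsDelaySolution {m : ℕ} (a : ℝ → ℝ) (b h : Fin m → ℝ → ℝ) (t₀ : ℝ)
    (φ x : ℝ → ℝ) : Prop where
  initial : ∀ t, t ≤ t₀ → x t = φ t
  absCont : ∀ T, t₀ ≤ T → AbsolutelyContinuousOnInterval x t₀ T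
  equation : ∀ᵐ t ∂MeasureTheory.volume, t₀ ≤ t →
    HasDerivAt x (-(a t * x t + ∑ k, b k t * x (h k t))) t

/-- Exponential stability of `x'(t) + a(t) x(t) + ∑ₖ bₖ(t) x(hₖ(t)) = 0`, `t ≥ 0`: constants
`M, α > 0`, independent of the initial point `t₀ ≥ 0` and of the bounded Borel measurable initial
function `φ`, such that `|x(t)| ≤ M ‖φ‖ e^{-α (t - t₀)}` for `t ≥ t₀`, where `‖φ‖` is the supremum
of `|φ|` on `(-∞, t₀]`. -/
def IsExponentiallyStable {m : ℕ} (a : ℝ → ℝ) (b h : Fin m → ℝ → ℝ) : Prop :=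
  ∃ M α : ℝ, 0 < M ∧ 0 < α ∧
    ∀ t₀ : ℝ, 0 ≤ t₀ → ∀ φ : ℝ → ℝ, Measurable φ →
      (∃ K : ℝ, ∀ s, s ≤ t₀ → |φ s| ≤ K) →
      ∀ x : ℝ → ℝ, IsDelaySolution a b h t₀ φ x →
        ∀ t, t₀ ≤ t → |x t| ≤ M * (⨆ s : Set.Iic t₀, |φ s|) * Real.exp (-α * (t - t₀))

/-!
# Exponential stability of a linear equation with several delays

Measure time by the clock `A t = ∫₀ᵗ a`. On this clock the equation reads `x' = -x - g`, where the
delayed term `g` looks back by at most `τ`, slightly more than `h₀`, and has gain at most `β'`,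
slightly more than `β` (`IsDelayedFeedback`). Instead of substituting, the proof multiplies by the
integrating factor `exp (A t)` and compares with explicit functions of `A t`
(`IsClock.exp_mul_sub_le`).

The heart is an estimate of a hump following a zero `t₁` (`le_humpRatio`). Suppose `-c ≤ x` before
`t₁` and `x ≥ 0` on `[t₁, t]`. Going backwards from the zero gives
`x v ≥ -β c (exp (A t₁ - A v) - 1)`, so, after `t₁`, the delayed term pushes `x` upwards at most at
the rate `β c min (1, β (exp (A t₁ + τ - A u) - 1))`. Integrating this and maximizing yields
`x t ≤ ρ c` with `ρ = (1 + β) β exp (-exp (-τ) / β) - β²`, and `ρ < 1` is exactly the condition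
`exp (-τ) / β > log ((β² + β) / (β² + 1))`. The computation assumes that the minimum switches after
`t₁`, that is `1 + β ≤ β exp τ`. This is no loss: for gains at least one, `τ` can be enlarged until
it holds without violating the condition (`exists_gain_delay`).

Looking back at the last zero, or else using that a solution of constant sign decays like
`exp (-A)`, one finds that `sup |x|` shrinks by a fixed factor over each clock time `3 τ + 1`
(`abs_le_contractionFactor`); this gives exponential decay (`abs_le_exp`). The bounds on gain and
delay only hold from some time `T` on, and up to then, and over the first stretch after it, a
Grönwall bound (`abs_le_exp_of_abs_deriv_le`) controls the solution by the initial function.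
-/

open MeasureTheory Set

/-! ### Comparison for absolutely continuous functions -/

/-- An absolutely continuous function whose derivative is nonpositive almost everywhere does not
increase. -/
theorem AbsolutelyContinuousOnInterval.le_of_ae_deriv_nonpos {f : ℝ → ℝ} {p q : ℝ}
    (hpq : p ≤ q) (hf : AbsolutelyContinuousOnInterval f p q)
    (hd : ∀ᵐ u, u ∈ Icc p q → ∃ d ≤ 0, HasDerivAt f d u) : f q ≤ f p := by
  have h1 := hf.integral_deriv_eq_sub
  have h2 : 0 ≤ ∫ u in p..q, -deriv f u := by
    apply intervalIntegral.integral_nonneg_of_ae_restrict hpq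
    rw [Filter.EventuallyLE, ae_restrict_iff' measurableSet_Icc]
    filter_upwards [hd] with u hu hmem
    obtain ⟨d, hd0, hd⟩ := hu hmem
    rw [hd.deriv]
    simpa using hd0
  rw [intervalIntegral.integral_neg] at h2
  linarith

theorem ContDiff.absolutelyContinuousOnInterval_comp {G A : ℝ → ℝ} {K : NNReal}
    (hG : ContDiff ℝ 1 G) (hA : LipschitzWith K A) (p q : ℝ) :
    AbsolutelyContinuousOnInterval (fun u => G (A u)) p q := by
  have h1 : LocallyLipschitz (fun u => G (A u)) :=
    hG.locallyLipschitz.comp hA.locallyLipschitz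
  obtain ⟨L, hL⟩ := LocallyLipschitzOn.exists_lipschitzOnWith_of_compact isCompact_uIcc
    (h1.locallyLipschitzOn (s := uIcc p q))
  exact hL.absolutelyContinuousOnInterval

/-- `A` is a primitive of the damping coefficient `a`, used as a new time variable: it is
Lipschitz, it has derivative `a ≥ 0` almost everywhere, and it grows at least at the rate
`a₀ > 0`. -/
structure IsClock (a A : ℝ → ℝ) (a₀ : ℝ) : Prop where
  pos : 0 < a₀
  nonneg : ∀ t, 0 ≤ a t
  lipschitz : ∃ K, LipschitzWith K A
  growth : ∀ s t, s ≤ t → a₀ * (t - s) ≤ A t - A s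
  deriv : ∀ᵐ t, HasDerivAt A (a t) t

namespace IsClock

variable {a A : ℝ → ℝ} {a₀ : ℝ}

theorem strictMono (hA : IsClock a A a₀) : StrictMono A := by
  intro s t hst
  have := hA.growth s t hst.le
  have := mul_pos hA.pos (sub_pos.2 hst)
  linarith

theorem continuous (hA : IsClock a A a₀) : Continuous A := by
  obtain ⟨K, hK⟩ := hA.lipschitz
  exact hK.continuous

/-- The clock reaches every later value, and does so within the time allowed by its growth. -/
theorem exists_eq (hA : IsClock a A a₀) {s y : ℝ} (hy : A s ≤ y) :
    ∃ t, s ≤ t ∧ A t = y ∧ a₀ * (t - s) ≤ y - A s := by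
  have h0 : 0 ≤ (y - A s) / a₀ := div_nonneg (by linarith) hA.pos.le
  have h1 : s ≤ s + (y - A s) / a₀ := by linarith
  have h2 := hA.growth _ _ h1
  have h3 : a₀ * (s + (y - A s) / a₀ - s) = y - A s := by
    have := hA.pos.ne'
    field_simp
    ring
  obtain ⟨t, ht, hty⟩ := intermediate_value_Icc h1 hA.continuous.continuousOn
    (show y ∈ Icc (A s) (A (s + (y - A s) / a₀)) from ⟨hy, by linarith⟩)
  refine ⟨t, ht.1, hty, ?_⟩
  have := hA.growth _ _ ht.1
  linarith

/-- The integrating factor `exp A` turns a lower bound for the perturbation `f` in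
`x' = -(a x + f)` into an upper bound for `x` in terms of a function `G` of the clock. -/
theorem exp_mul_sub_le (hA : IsClock a A a₀) {x f G G' : ℝ → ℝ} {p q : ℝ} (hpq : p ≤ q)
    (hx : AbsolutelyContinuousOnInterval x p q)
    (heq : ∀ᵐ u, u ∈ Icc p q → HasDerivAt x (-(a u * x u + f u)) u)
    (hG : ContDiff ℝ 1 G) (hG' : ∀ v, HasDerivAt G (G' v) v)
    (hf : ∀ u ∈ Icc p q, -(f u * Real.exp (A u)) ≤ a u * G' (A u)) :
    x q * Real.exp (A q) - x p * Real.exp (A p) ≤ G (A q) - G (A p) := by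
  obtain ⟨K, hK⟩ := hA.lipschitz
  have hE : AbsolutelyContinuousOnInterval (fun u => Real.exp (A u)) p q :=
    Real.contDiff_exp.absolutelyContinuousOnInterval_comp hK p q
  have hAC := (hx.mul hE).sub (hG.absolutelyContinuousOnInterval_comp hK p q)
  have := hAC.le_of_ae_deriv_nonpos hpq (by
    filter_upwards [heq, hA.deriv] with u hu hAu hmem
    refine ⟨_, ?_, ((hu hmem).mul hAu.exp).sub ((hG' (A u)).comp u hAu)⟩
    have := hf u hmem
    linarith)
  simp only [Pi.sub_apply, Pi.mul_apply] at this
  linarith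

end IsClock

/-! ### The first extremum after a zero -/

/-- The equation `x' = -(a x + f)` on `[s, ∞)`, where `f` is a delayed feedback of gain at most
`β` relative to `a`: on the clock `A` the delay is at most `τ`, and a bound `-c ≤ x` or `x ≤ c`
on the delay window gives the corresponding bound for `f`. -/
structure IsDelayedFeedback (a A f x : ℝ → ℝ) (β τ s : ℝ) : Prop where
  absCont : ∀ t, s ≤ t → AbsolutelyContinuousOnInterval x s t
  equation : ∀ᵐ u, s ≤ u → HasDerivAt x (-(a u * x u + f u)) u
  lower : ∀ u, s ≤ u → ∀ c, 0 ≤ c → (∀ v, A u - τ ≤ A v → v ≤ u → -c ≤ x v) →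
    -(a u * (β * c)) ≤ f u
  upper : ∀ u, s ≤ u → ∀ c, 0 ≤ c → (∀ v, A u - τ ≤ A v → v ≤ u → x v ≤ c) →
    f u ≤ a u * (β * c)

/-- The factor by which, in the worst case, the extremum following a zero is smaller than the
preceding bound. It is the maximum over `w ≥ 0` of `(1 + β) β e^{-w} (1 + w - q) - β²` with
`q = e^{-τ} / β`, attained at `w = q`. -/
noncomputable def humpRatio (β τ : ℝ) : ℝ :=
  (1 + β) * β * Real.exp (-(Real.exp (-τ) / β)) - β ^ 2

namespace IsDelayedFeedback

variable {a A f x : ℝ → ℝ} {a₀ β τ s : ℝ}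

theorem neg (hx : IsDelayedFeedback a A f x β τ s) :
    IsDelayedFeedback a A (fun t => -f t) (fun t => -x t) β τ s where
  absCont t ht := (hx.absCont t ht).neg
  equation := by
    filter_upwards [hx.equation] with u hu hs
    exact (hu hs).neg.congr_deriv (by ring)
  lower u hu c hc h := by
    have := hx.upper u hu c hc fun v h1 h2 => by linarith [h v h1 h2]
    linarith
  upper u hu c hc h := by
    have := hx.lower u hu c hc fun v h1 h2 => by linarith [h v h1 h2]
    linarith

theorem continuousOn (hx : IsDelayedFeedback a A f x β τ s) (t : ℝ) : ContinuousOn x (Icc s t) := by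
  rcases le_or_gt s t with h | h
  · simpa [uIcc_of_le h] using (hx.absCont t h).continuousOn
  · simp [Icc_eq_empty (not_le.2 h)]

theorem exp_mul_sub_le (hx : IsDelayedFeedback a A f x β τ s) (hA : IsClock a A a₀) {G G' : ℝ → ℝ}
    {p q : ℝ} (hsp : s ≤ p) (hpq : p ≤ q) (hG : ContDiff ℝ 1 G) (hG' : ∀ v, HasDerivAt G (G' v) v)
    (hf : ∀ u ∈ Icc p q, -(f u * Real.exp (A u)) ≤ a u * G' (A u)) :
    x q * Real.exp (A q) - x p * Real.exp (A p) ≤ G (A q) - G (A p) := by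
  refine hA.exp_mul_sub_le hpq ((hx.absCont q (hsp.trans hpq)).mono ?_) ?_ hG hG' hf
  · rw [uIcc_of_le hpq, uIcc_of_le (hsp.trans hpq)]
    exact Icc_subset_Icc_left hsp
  · filter_upwards [hx.equation] with u hu hmem
    exact hu (hsp.trans hmem.1)

/-- Growth bound from `-c ≤ x` on the delay windows. -/
theorem exp_mul_sub_le_of_neg_le (hx : IsDelayedFeedback a A f x β τ s) (hA : IsClock a A a₀)
    {c p q : ℝ} (hc : 0 ≤ c) (hsp : s ≤ p) (hpq : p ≤ q)
    (hlow : ∀ u ∈ Icc p q, ∀ v, A u - τ ≤ A v → v ≤ u → -c ≤ x v) :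
    x q * Real.exp (A q) - x p * Real.exp (A p) ≤
      β * c * (Real.exp (A q) - Real.exp (A p)) := by
  have h := hx.exp_mul_sub_le hA (G := fun v => β * c * Real.exp v)
    (G' := fun v => β * c * Real.exp v) hsp hpq (by fun_prop)
    (fun v => (Real.hasDerivAt_exp v).const_mul _) (by
      intro u hu
      have h1 := hx.lower u (hsp.trans hu.1) c hc (hlow u hu)
      nlinarith [Real.exp_pos (A u)])
  linarith

/-- As long as `x` stays nonnegative over a whole delay window it decays with the clock. -/
theorem le_mul_exp_of_nonneg (hx : IsDelayedFeedback a A f x β τ s) (hA : IsClock a A a₀)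
    {p q : ℝ} (hsp : s ≤ p) (hpq : p ≤ q)
    (hlow : ∀ u ∈ Icc p q, ∀ v, A u - τ ≤ A v → v ≤ u → 0 ≤ x v) :
    x q ≤ x p * Real.exp (-(A q - A p)) := by
  have h := hx.exp_mul_sub_le_of_neg_le hA le_rfl hsp hpq (by simpa using hlow)
  have h1 : x q * Real.exp (A q) ≤ x p * Real.exp (A p) := by linarith
  have h2 : Real.exp (-(A q - A p)) = Real.exp (A p) * Real.exp (-A q) := by
    rw [← Real.exp_add]; congr 1; ring
  rw [h2, ← mul_assoc]
  have h3 := mul_le_mul_of_nonneg_right h1 (Real.exp_pos (-A q)).le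
  rwa [mul_assoc, ← Real.exp_add, add_neg_cancel, Real.exp_zero, mul_one] at h3

/-- Going backwards from a zero `t₁`, `x` cannot have been too negative. -/
theorem neg_le_before_zero (hx : IsDelayedFeedback a A f x β τ s) (hA : IsClock a A a₀)
    {c t₁ u : ℝ} (hc : 0 ≤ c) (hs : A s + 2 * τ ≤ A t₁) (h0 : x t₁ = 0) (hτ : 0 ≤ τ)
    (hlow : ∀ v ∈ Icc s t₁, -c ≤ x v) (hu : A t₁ - τ ≤ A u) (hut : u ≤ t₁) :
    -(β * c * (Real.exp (A t₁ - A u) - 1)) ≤ x u := by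
  have hsu : s ≤ u := hA.strictMono.le_iff_le.1 (by linarith)
  have h := hx.exp_mul_sub_le_of_neg_le hA hc hsu hut (by
    intro w hw v hv hvw
    have : A u ≤ A w := hA.strictMono.monotone hw.1
    exact hlow v ⟨hA.strictMono.le_iff_le.1 (by linarith), hvw.trans hw.2⟩)
  rw [h0] at h
  rw [Real.exp_sub]
  have hpos := Real.exp_pos (A u)
  rw [← sub_nonneg]
  have : 0 ≤ (x u * Real.exp (A u) + β * c * (Real.exp (A t₁) - Real.exp (A u))) /
      Real.exp (A u) := div_nonneg (by linarith) hpos.le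
  convert this using 1
  field_simp
  ring

/-- The hump estimate while the delay window still reaches back to the zero `t₁`. Up to clock time
`A t₁ + s₀` the bound `-c ≤ x` is used, afterwards the one of `neg_le_before_zero`. -/
theorem le_humpRatio_of_clock_le (hx : IsDelayedFeedback a A f x β τ s) (hA : IsClock a A a₀)
    {c t₁ t : ℝ} (hβ : 0 < β) (hτβ : 1 + β ≤ β * Real.exp τ) (hτ : 0 ≤ τ)
    (hc : 0 ≤ c) (hs : A s + 2 * τ ≤ A t₁) (h0 : x t₁ = 0) (ht : t₁ ≤ t)
    (hlow : ∀ v ∈ Icc s t₁, -c ≤ x v) (hpos : ∀ v ∈ Icc t₁ t, 0 ≤ x v) (htτ : A t ≤ A t₁ + τ) :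
    x t ≤ humpRatio β τ * c := by
  have hst : s ≤ t₁ := hA.strictMono.le_iff_le.1 (by linarith)
  set S := Real.exp (A t₁) with hS
  set T := Real.exp τ with hT
  have hS0 : 0 < S := Real.exp_pos _
  have hT0 : 0 < T := Real.exp_pos _
  -- the crude bound `-c ≤ x` holds on every delay window met on `[t₁, t]`
  have hwin : ∀ u ∈ Icc t₁ t, ∀ v, A u - τ ≤ A v → v ≤ u → -c ≤ x v := by
    intro u hu v hv hvu
    have h1 : A t₁ ≤ A u := hA.strictMono.monotone hu.1
    rcases le_total v t₁ with h | h
    · exact hlow v ⟨hA.strictMono.le_iff_le.1 (by linarith), h⟩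
    · linarith [hpos v ⟨h, hvu.trans hu.2⟩]
  have hq : Real.exp (-τ) / β = 1 / (β * T) := by
    rw [Real.exp_neg, hT]; field_simp
  have crude : ∀ r ∈ Icc t₁ t, x r * Real.exp (A r) ≤ β * c * (Real.exp (A r) - S) := by
    intro r hr
    have := hx.exp_mul_sub_le_of_neg_le hA hc hst hr.1
      (fun u hu => hwin u ⟨hu.1, hu.2.trans hr.2⟩)
    rw [h0] at this
    linarith
  have hP0 : 0 < Real.exp (A t) := Real.exp_pos _
  suffices hmain : x t * Real.exp (A t) ≤ humpRatio β τ * c * Real.exp (A t) from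
    le_of_mul_le_mul_right hmain hP0
  -- the two lower bounds for `x` on the delay window agree at clock time `A t₁ + s₀`
  set s₀ := Real.log (β * T / (1 + β)) with hs₀
  have hes₀ : Real.exp s₀ = β * T / (1 + β) := Real.exp_log (by positivity)
  have hs₀0 : 0 ≤ s₀ := Real.log_nonneg ((one_le_div (by positivity)).2 hτβ)
  obtain ⟨t₀, ht₀, hAt₀, -⟩ := hA.exists_eq (s := t₁) (y := A t₁ + s₀) (by linarith)
  have hP0eq : (1 + β) * Real.exp (A t₀) = β * T * S := by
    rw [hAt₀, Real.exp_add, hes₀, ← hS]; field_simp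
  rcases le_total t t₀ with htt | htt
  · refine (crude t ⟨ht, le_rfl⟩).trans ?_
    have h1 : Real.exp (A t) ≤ Real.exp (A t₀) := Real.exp_le_exp.2 (hA.strictMono.monotone htt)
    have h2 : (1 + β) * β * (1 - 1 / (β * T)) - β ^ 2 ≤ humpRatio β τ := by
      unfold humpRatio
      rw [hq]
      have := Real.add_one_le_exp (-(1 / (β * T)))
      have : 1 - 1 / (β * T) ≤ Real.exp (-(1 / (β * T))) := by linarith
      have := mul_le_mul_of_nonneg_left this (show 0 ≤ (1 + β) * β by positivity)
      linarith
    have h3 : (1 + β) * β * (1 - 1 / (β * T)) - β ^ 2 = β - (1 + β) / T := by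
      field_simp; ring
    have h4 : (1 + β) / T * Real.exp (A t) ≤ β * S := by
      rw [div_mul_eq_mul_div, div_le_iff₀ hT0]
      nlinarith
    have h5 : β * (Real.exp (A t) - S) ≤ humpRatio β τ * Real.exp (A t) := by nlinarith
    nlinarith
  · have hfine := hx.exp_mul_sub_le hA (p := t₀) (q := t)
      (G := fun v => c * β ^ 2 * (T * S * v - Real.exp v))
      (G' := fun v => c * β ^ 2 * (T * S * 1 - Real.exp v)) (hst.trans ht₀) htt (by fun_prop)
      (fun v => (((hasDerivAt_id v).const_mul _).sub (Real.hasDerivAt_exp v)).const_mul _) (by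
        intro u hu
        have hAu : A u ≤ A t₁ + τ := (hA.strictMono.monotone hu.2).trans htτ
        have ht₁u : t₁ ≤ u := ht₀.trans hu.1
        have hAu' : A t₁ ≤ A u := hA.strictMono.monotone ht₁u
        have hge : 1 ≤ Real.exp (A t₁ + τ - A u) := Real.one_le_exp (by linarith)
        have hd : 0 ≤ β * c * (Real.exp (A t₁ + τ - A u) - 1) :=
          mul_nonneg (by positivity) (by linarith)
        have h1 := hx.lower u (hst.trans ht₁u) _ hd (by
          intro v hv hvu
          rcases le_total v t₁ with h | h
          · have h2 := hx.neg_le_before_zero hA hc hs h0 hτ hlow (by linarith) h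
            have h3 : Real.exp (A t₁ - A v) ≤ Real.exp (A t₁ + τ - A u) :=
              Real.exp_le_exp.2 (by linarith)
            have h4 := mul_le_mul_of_nonneg_left h3 (show 0 ≤ β * c by positivity)
            linarith
          · linarith [hpos v ⟨h, hvu.trans hu.2⟩])
        have h2 := mul_le_mul_of_nonneg_right h1 (Real.exp_pos (A u)).le
        have h3 : Real.exp (A t₁ + τ - A u) * Real.exp (A u) = T * S := by
          rw [← Real.exp_add, hT, hS, ← Real.exp_add]; ring_nf
        calc -(f u * Real.exp (A u)) ≤
            a u * (β * (β * c * (Real.exp (A t₁ + τ - A u) - 1))) * Real.exp (A u) := by linarith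
          _ = a u * (c * β ^ 2 * (Real.exp (A t₁ + τ - A u) * Real.exp (A u) -
            Real.exp (A u))) := by ring
          _ = _ := by rw [h3, mul_one])
    have hc0 := crude t₀ ⟨ht₀, htt⟩
    set w := A t - A t₀ with hw
    have hPw : Real.exp (A t) = Real.exp (A t₀) * Real.exp w := by
      rw [← Real.exp_add]; congr 1; linarith
    have hkey : 1 + w - 1 / (β * T) ≤ Real.exp (w - 1 / (β * T)) := by
      have := Real.add_one_le_exp (w - 1 / (β * T)); linarith
    have h1 : x t * Real.exp (A t) ≤
        c * (β ^ 2 * T * S * (1 + w) - β * S - β ^ 2 * Real.exp (A t)) := by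
      have : c * β * ((1 + β) * Real.exp (A t₀)) = c * β * (β * T * S) := by rw [hP0eq]
      have hw' : A t = A t₀ + w := by linarith
      rw [hw'] at hfine ⊢
      linarith
    refine h1.trans ?_
    have h2 : β ^ 2 * T * S * (1 + w) - β * S = β ^ 2 * T * S * (1 + w - 1 / (β * T)) := by
      field_simp
    have h3 : β ^ 2 * T * S * Real.exp (w - 1 / (β * T)) =
        (1 + β) * β * Real.exp (-(1 / (β * T))) * Real.exp (A t) := by
      rw [hPw, sub_eq_add_neg, Real.exp_add]
      linear_combination (-β * Real.exp w * Real.exp (-(1 / (β * T)))) * hP0eq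
    have h4 := mul_le_mul_of_nonneg_left hkey (show 0 ≤ β ^ 2 * T * S by positivity)
    have h5 : β ^ 2 * T * S * (1 + w) - β * S - β ^ 2 * Real.exp (A t) ≤
        humpRatio β τ * Real.exp (A t) := by
      unfold humpRatio
      rw [hq]
      linarith
    have := mul_le_mul_of_nonneg_left h5 hc
    linarith

/-- If `x` vanishes at `t₁` and stays nonnegative on `[t₁, t]`, then `x t` is at most `humpRatio`
times an earlier bound for the negative part of `x`. -/
theorem le_humpRatio (hx : IsDelayedFeedback a A f x β τ s) (hA : IsClock a A a₀)
    {c t₁ t : ℝ} (hβ : 0 < β) (hτβ : 1 + β ≤ β * Real.exp τ) (hτ : 0 ≤ τ)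
    (hc : 0 ≤ c) (hs : A s + 2 * τ ≤ A t₁) (h0 : x t₁ = 0) (ht : t₁ ≤ t)
    (hlow : ∀ v ∈ Icc s t₁, -c ≤ x v) (hpos : ∀ v ∈ Icc t₁ t, 0 ≤ x v) :
    x t ≤ humpRatio β τ * c := by
  rcases le_total (A t) (A t₁ + τ) with h | h
  · exact hx.le_humpRatio_of_clock_le hA hβ hτβ hτ hc hs h0 ht hlow hpos h
  -- after clock time `A t₁ + τ` the delayed values are nonnegative, so `x` decreases
  · have hst : s ≤ t₁ := hA.strictMono.le_iff_le.1 (by linarith)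
    obtain ⟨r, hr, hAr, -⟩ := hA.exists_eq (s := t₁) (y := A t₁ + τ) (by linarith)
    have hrt : r ≤ t := hA.strictMono.le_iff_le.1 (by linarith)
    have h1 := hx.le_humpRatio_of_clock_le hA hβ hτβ hτ hc hs h0 hr hlow
      (fun v hv => hpos v ⟨hv.1, hv.2.trans hrt⟩) hAr.le
    have h2 := hx.le_mul_exp_of_nonneg hA (hst.trans hr) hrt (by
      intro u hu v hv hvu
      have : A r ≤ A u := hA.strictMono.monotone hu.1
      exact hpos v ⟨hA.strictMono.le_iff_le.1 (by linarith), hvu.trans hu.2⟩)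
    have h3 : Real.exp (-(A t - A r)) ≤ 1 := Real.exp_le_one_iff.2 (by linarith)
    have h4 := hpos r ⟨hr, hrt⟩
    nlinarith

end IsDelayedFeedback

/-! ### Contraction and exponential decay -/

/-- The factor by which the supremum of `|x|` shrinks over a clock time of length `3 τ + 1`. -/
noncomputable def contractionFactor (β τ : ℝ) : ℝ :=
  max (humpRatio β τ) (Real.exp (-1))

theorem contractionFactor_pos (β τ : ℝ) : 0 < contractionFactor β τ :=
  lt_max_of_lt_right (Real.exp_pos _)

namespace IsDelayedFeedback

variable {a A f x : ℝ → ℝ} {a₀ β τ s : ℝ}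

theorem mono (hx : IsDelayedFeedback a A f x β τ s) {s' : ℝ} (h : s ≤ s') :
    IsDelayedFeedback a A f x β τ s' where
  absCont t ht := (hx.absCont t (h.trans ht)).mono (by
    rw [uIcc_of_le ht, uIcc_of_le (h.trans ht)]
    exact Icc_subset_Icc_left h)
  equation := hx.equation.mono fun u hu h' => hu (h.trans h')
  lower u hu := hx.lower u (h.trans hu)
  upper u hu := hx.upper u (h.trans hu)

theorem le_contractionFactor_of_pos (hx : IsDelayedFeedback a A f x β τ s) (hA : IsClock a A a₀)
    {c t : ℝ} (hβ : 0 < β) (hτβ : 1 + β ≤ β * Real.exp τ) (hτ : 0 ≤ τ)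
    (ht : A s + (3 * τ + 1) ≤ A t) (hc : ∀ v ∈ Icc s t, |x v| ≤ c) (hpos : 0 < x t) :
    x t ≤ contractionFactor β τ * c := by
  have hst : s ≤ t := hA.strictMono.le_iff_le.1 (by linarith)
  have hc0 : 0 ≤ c := (abs_nonneg _).trans (hc t ⟨hst, le_rfl⟩)
  obtain ⟨r, hsr, hAr, -⟩ := hA.exists_eq (s := s) (y := A s + 2 * τ) (by linarith)
  have hrt : r ≤ t := hA.strictMono.le_iff_le.1 (by linarith)
  have hcont : ContinuousOn x (Icc r t) := (hx.continuousOn t).mono (Icc_subset_Icc_left hsr)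
  -- `x` is nonnegative back to its last zero
  have hsign : ∀ v ∈ Icc r t, (∀ u ∈ Icc r t, x u = 0 → u ≤ v) → 0 ≤ x v := by
    intro v hv hz
    by_contra! hneg
    obtain ⟨u, hu, hu0⟩ := intermediate_value_Icc hv.2 (hcont.mono (Icc_subset_Icc_left hv.1))
      (show (0 : ℝ) ∈ Icc (x v) (x t) from ⟨hneg.le, hpos.le⟩)
    have huv := hz u ⟨hv.1.trans hu.1, hu.2⟩ hu0
    have : u = v := le_antisymm huv hu.1
    rw [this] at hu0
    linarith
  by_cases hZ : ∃ u ∈ Icc r t, x u = 0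
  · have hcomp : IsCompact (Icc r t ∩ x ⁻¹' {0}) :=
      isCompact_Icc.of_isClosed_subset
        (hcont.preimage_isClosed_of_isClosed isClosed_Icc isClosed_singleton) inter_subset_left
    obtain ⟨t₁, ⟨ht₁, h0⟩, hmax⟩ := hcomp.exists_isGreatest
      (by obtain ⟨u, hu, h0⟩ := hZ; exact ⟨u, hu, h0⟩)
    have h := hx.le_humpRatio hA hβ hτβ hτ hc0
      (by rw [← hAr]; exact hA.strictMono.monotone ht₁.1) h0 ht₁.2
      (fun v hv => (abs_le.1 (hc v ⟨hv.1, hv.2.trans ht₁.2⟩)).1)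
      (fun v hv => hsign v ⟨ht₁.1.trans hv.1, hv.2⟩ fun u hu hu0 => (hmax ⟨hu, hu0⟩).trans hv.1)
    exact h.trans (mul_le_mul_of_nonneg_right (le_max_left _ _) hc0)
  · push Not at hZ
    obtain ⟨p, hsp, hAp, -⟩ := hA.exists_eq (s := s) (y := A s + 3 * τ) (by linarith)
    have hpt : p ≤ t := hA.strictMono.le_iff_le.1 (by linarith)
    have h := hx.le_mul_exp_of_nonneg hA hsp hpt (by
      intro u hu v hv hvu
      have : A p ≤ A u := hA.strictMono.monotone hu.1
      exact hsign v ⟨hA.strictMono.le_iff_le.1 (by linarith), hvu.trans hu.2⟩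
        fun w hw hw0 => absurd hw0 (hZ w hw))
    have h1 := (abs_le.1 (hc p ⟨hsp, hpt⟩)).2
    calc x t ≤ x p * Real.exp (-(A t - A p)) := h
      _ ≤ c * Real.exp (-1) := by
        refine mul_le_mul h1 (Real.exp_le_exp.2 (by linarith)) (Real.exp_pos _).le hc0
      _ ≤ contractionFactor β τ * c := by
        rw [mul_comm]
        exact mul_le_mul_of_nonneg_right (le_max_right _ _) hc0

/-- A bound for `|x|` on `[s, t]` improves at `t` by the contraction factor, once the clock has
advanced by `3 τ + 1`: either `x` has vanished in the meantime and `le_humpRatio` applies to the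
last zero, or `x` has kept its sign and decays with the clock. -/
theorem abs_le_contractionFactor (hx : IsDelayedFeedback a A f x β τ s) (hA : IsClock a A a₀)
    {c t : ℝ} (hβ : 0 < β) (hτβ : 1 + β ≤ β * Real.exp τ) (hτ : 0 ≤ τ)
    (ht : A s + (3 * τ + 1) ≤ A t) (hc : ∀ v ∈ Icc s t, |x v| ≤ c) :
    |x t| ≤ contractionFactor β τ * c := by
  rcases lt_trichotomy (x t) 0 with h | h | h
  · rw [abs_of_neg h]
    exact hx.neg.le_contractionFactor_of_pos hA hβ hτβ hτ ht (by simpa using hc) (by linarith)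
  · have hst : s ≤ t := hA.strictMono.le_iff_le.1 (by linarith)
    rw [h, abs_zero]
    exact mul_nonneg (contractionFactor_pos β τ).le
      ((abs_nonneg _).trans (hc t ⟨hst, le_rfl⟩))
  · rw [abs_of_pos h]
    exact hx.le_contractionFactor_of_pos hA hβ hτβ hτ ht hc h

theorem abs_le_of_initial (hx : IsDelayedFeedback a A f x β τ s) (hA : IsClock a A a₀)
    {c t : ℝ} (hβ : 0 < β) (hτβ : 1 + β ≤ β * Real.exp τ) (hτ : 0 ≤ τ)
    (hθ : contractionFactor β τ < 1)
    (hc : ∀ v, s ≤ v → A v ≤ A s + (3 * τ + 1) → |x v| ≤ c) (ht : s ≤ t) : |x t| ≤ c := by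
  -- the maximum of `|x|` on `[s, t]` cannot be attained beyond the initial stretch
  obtain ⟨r, hr, hmax⟩ := isCompact_Icc.exists_isMaxOn (nonempty_Icc.2 ht)
    (hx.continuousOn t).abs
  have hle : |x t| ≤ |x r| := hmax ⟨ht, le_rfl⟩
  rcases le_total (A r) (A s + (3 * τ + 1)) with h | h
  · exact hle.trans (hc r hr.1 h)
  · have h1 := hx.abs_le_contractionFactor hA hβ hτβ hτ h
      (fun v hv => hmax ⟨hv.1, hv.2.trans hr.2⟩)
    have h2 := hc s le_rfl (by linarith)
    have h3 := abs_nonneg (x s)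
    have h4 := abs_nonneg (x r)
    simp only at h1
    nlinarith

theorem abs_le_pow (hx : IsDelayedFeedback a A f x β τ s) (hA : IsClock a A a₀)
    {c : ℝ} (hβ : 0 < β) (hτβ : 1 + β ≤ β * Real.exp τ) (hτ : 0 ≤ τ)
    (hc : ∀ t, s ≤ t → |x t| ≤ c) (n : ℕ) :
    ∀ t, A s + n * (3 * τ + 1) ≤ A t → |x t| ≤ contractionFactor β τ ^ n * c := by
  induction n with
  | zero =>
    intro t ht
    simpa using hc t (hA.strictMono.le_iff_le.1 (by simpa using ht))
  | succ n ih =>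
    intro t ht
    push_cast at ht
    obtain ⟨r, hr, hAr, -⟩ := hA.exists_eq (s := s) (y := A s + n * (3 * τ + 1))
      (by have : 0 ≤ (n : ℝ) * (3 * τ + 1) := by positivity
          linarith)
    have := (hx.mono hr).abs_le_contractionFactor hA hβ hτβ hτ (t := t) (by linarith)
      (fun v hv => ih v (by rw [← hAr]; exact hA.strictMono.monotone hv.1))
    rwa [pow_succ', mul_assoc]

/-- Exponential decay of a delayed feedback equation whose contraction factor is below one. -/
theorem abs_le_exp (hx : IsDelayedFeedback a A f x β τ s) (hA : IsClock a A a₀)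
    {c t : ℝ} (hβ : 0 < β) (hτβ : 1 + β ≤ β * Real.exp τ) (hτ : 0 ≤ τ)
    (hθ : contractionFactor β τ < 1)
    (hc : ∀ v, s ≤ v → A v ≤ A s + (3 * τ + 1) → |x v| ≤ c) (ht : s ≤ t) :
    |x t| ≤ c * (contractionFactor β τ)⁻¹ *
      Real.exp (-(-Real.log (contractionFactor β τ) * a₀ / (3 * τ + 1)) * (t - s)) := by
  set θ := contractionFactor β τ
  have hθ0 : 0 < θ := contractionFactor_pos β τ
  have hL : 0 < 3 * τ + 1 := by positivity
  have hc0 : 0 ≤ c := (abs_nonneg _).trans (hc s le_rfl (by linarith))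
  have hgrow := hA.growth s t ht
  set y := a₀ * (t - s) / (3 * τ + 1) with hy
  have hy0 : 0 ≤ y := div_nonneg (mul_nonneg hA.pos.le (by linarith)) hL.le
  have hn : (⌊y⌋₊ : ℝ) * (3 * τ + 1) ≤ a₀ * (t - s) := by
    have := mul_le_mul_of_nonneg_right (Nat.floor_le hy0) hL.le
    rwa [hy, div_mul_cancel₀ _ hL.ne'] at this
  have h1 := hx.abs_le_pow hA hβ hτβ hτ
    (fun t ht => hx.abs_le_of_initial hA hβ hτβ hτ hθ hc ht) ⌊y⌋₊ t (by linarith)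
  have hlog : Real.log θ ≤ 0 := Real.log_nonpos hθ0.le hθ.le
  have h2 : θ ^ ⌊y⌋₊ ≤ θ⁻¹ * Real.exp (Real.log θ * y) := by
    have e1 : θ ^ ⌊y⌋₊ = Real.exp (Real.log θ * ⌊y⌋₊) := by
      rw [mul_comm, Real.exp_nat_mul, Real.exp_log hθ0]
    have e2 : θ⁻¹ = Real.exp (-Real.log θ) := by rw [Real.exp_neg, Real.exp_log hθ0]
    rw [e1, e2, ← Real.exp_add]
    apply Real.exp_le_exp.2
    have := Nat.lt_floor_add_one y
    nlinarith
  calc |x t| ≤ θ ^ ⌊y⌋₊ * c := h1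
    _ ≤ θ⁻¹ * Real.exp (Real.log θ * y) * c := mul_le_mul_of_nonneg_right h2 hc0
    _ = _ := by
      have : Real.log θ * y = -(-Real.log θ * a₀ / (3 * τ + 1)) * (t - s) := by
        rw [hy]; ring
      rw [this]; ring

end IsDelayedFeedback

/-! ### A priori growth -/

/-- Grönwall bound for a delay equation with arbitrary delays: `|x' u|` is at most `C` times the
supremum of `|x|` up to time `u`. -/
theorem abs_le_exp_of_abs_deriv_le {x : ℝ → ℝ} {t₀ K C : ℝ} (hK : 0 ≤ K) (hC : 0 ≤ C)
    (hAC : ∀ t, t₀ ≤ t → AbsolutelyContinuousOnInterval x t₀ t)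
    (hd : ∀ᵐ u, t₀ ≤ u → ∃ d, HasDerivAt x d u ∧ ∀ N, (∀ v ≤ u, |x v| ≤ N) → |d| ≤ C * N)
    (hini : ∀ v ≤ t₀, |x v| ≤ K) {t : ℝ} (ht : t₀ ≤ t) :
    |x t| ≤ K * Real.exp (2 * C * (t - t₀)) := by
  have hcont : ContinuousOn x (Icc t₀ t) := by
    simpa [uIcc_of_le ht] using (hAC t ht).continuousOn
  -- the rate `2 C` makes the weighted maximum `G` satisfy `G (e + 1) ≤ 2 K` with `e ≥ 1`
  obtain ⟨r, hr, hmax⟩ := isCompact_Icc.exists_isMaxOn (nonempty_Icc.2 ht)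
    (f := fun u => |x u| * Real.exp (-(2 * C * (u - t₀)))) (by fun_prop)
  set G := |x r| * Real.exp (-(2 * C * (r - t₀))) with hG
  have hle : ∀ u ∈ Icc t₀ t, |x u| ≤ G * Real.exp (2 * C * (u - t₀)) := by
    intro u hu
    have h1 : |x u| * Real.exp (-(2 * C * (u - t₀))) ≤ G := hmax hu
    rwa [Real.exp_neg, ← div_eq_mul_inv, div_le_iff₀ (Real.exp_pos _)] at h1
  suffices hGK : G ≤ K from
    (hle t ⟨ht, le_rfl⟩).trans (mul_le_mul_of_nonneg_right hGK (Real.exp_pos _).le)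
  by_contra! hKG
  have hG0 : 0 ≤ G := hK.trans hKG.le
  have hbd : ∀ u ∈ Icc t₀ r, ∀ v ≤ u, |x v| ≤ G * Real.exp (2 * C * (u - t₀)) := by
    intro u hu v hv
    rcases le_total v t₀ with h | h
    · have h1 : 1 ≤ Real.exp (2 * C * (u - t₀)) :=
        Real.one_le_exp (mul_nonneg (by positivity) (by linarith [hu.1]))
      have := hini v h
      nlinarith
    · refine (hle v ⟨h, hv.trans (hu.2.trans hr.2)⟩).trans (mul_le_mul_of_nonneg_left ?_ hG0)
      exact Real.exp_le_exp.2 (mul_le_mul_of_nonneg_left (by linarith) (by positivity))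
  have hexpd : ∀ u, HasDerivAt (fun u => G / 2 * Real.exp (2 * C * (u - t₀)))
      (C * (G * Real.exp (2 * C * (u - t₀)))) u := by
    intro u
    have h1 : HasDerivAt (fun u => 2 * C * (u - t₀)) (2 * C) u := by
      simpa using ((hasDerivAt_id u).sub_const t₀).const_mul (2 * C)
    exact (h1.exp.const_mul (G / 2)).congr_deriv (by ring)
  have hexpAC : AbsolutelyContinuousOnInterval
      (fun u => G / 2 * Real.exp (2 * C * (u - t₀))) t₀ r :=
    ContDiff.absolutelyContinuousOnInterval_comp (A := id)
      (G := fun u => G / 2 * Real.exp (2 * C * (u - t₀))) (by fun_prop) LipschitzWith.id t₀ r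
  have hup := ((hAC r hr.1).sub hexpAC).le_of_ae_deriv_nonpos hr.1 (by
    filter_upwards [hd] with u hu hmem
    obtain ⟨d, hdu, hN⟩ := hu hmem.1
    refine ⟨_, ?_, hdu.sub (hexpd u)⟩
    linarith [(abs_le.1 (hN _ (hbd u hmem))).2])
  have hdown := ((hAC r hr.1).neg.sub hexpAC).le_of_ae_deriv_nonpos hr.1 (by
    filter_upwards [hd] with u hu hmem
    obtain ⟨d, hdu, hN⟩ := hu hmem.1
    refine ⟨_, ?_, hdu.neg.sub (hexpd u)⟩
    linarith [(abs_le.1 (hN _ (hbd u hmem))).1])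
  simp only [Pi.sub_apply, Pi.neg_apply, sub_self, mul_zero, Real.exp_zero] at hup hdown
  have hx₀ := abs_le.1 (hini t₀ le_rfl)
  have hxr : |x r| ≤ K + G / 2 * (Real.exp (2 * C * (r - t₀)) - 1) :=
    abs_le.2 ⟨by linarith, by linarith⟩
  have hGe : G * Real.exp (2 * C * (r - t₀)) = |x r| := by
    rw [hG, mul_assoc, ← Real.exp_add, neg_add_cancel, Real.exp_zero, mul_one]
  have h1 : 1 ≤ Real.exp (2 * C * (r - t₀)) :=
    Real.one_le_exp (mul_nonneg (by positivity) (by linarith [hr.1]))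
  nlinarith

/-! ### The stability condition -/

theorem contractionFactor_lt_one {β τ : ℝ} (hβ : 0 < β)
    (h : Real.log ((β ^ 2 + β) / (β ^ 2 + 1)) < Real.exp (-τ) / β) :
    contractionFactor β τ < 1 := by
  refine max_lt ?_ (by simp)
  have h1 : (β ^ 2 + β) / (β ^ 2 + 1) < Real.exp (Real.exp (-τ) / β) :=
    (Real.log_lt_iff_lt_exp (by positivity)).1 h
  rw [div_lt_iff₀ (by positivity)] at h1
  unfold humpRatio
  rw [Real.exp_neg]
  have h2 := Real.exp_pos (Real.exp (-τ) / β)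
  have h3 : (1 + β) * β * (Real.exp (Real.exp (-τ) / β))⁻¹ < β ^ 2 + 1 := by
    rw [← div_eq_mul_inv, div_lt_iff₀ h2]
    linarith
  linarith

/-- The stability condition leaves room to enlarge the gain and the delay: strictly, so that they
bound the coefficients from some time on, and so far that the gain is at least one and
`1 + β' ≤ β' e^τ`. -/
theorem exists_gain_delay {β h₀ : ℝ}
    (hcond : β = 0 ∨ 1 / β * Real.exp (-h₀) > Real.log ((β ^ 2 + β) / (β ^ 2 + 1))) :
    ∃ β' τ, β < β' ∧ h₀ < τ ∧ 0 < β' ∧ 0 ≤ τ ∧ 1 + β' ≤ β' * Real.exp τ ∧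
      contractionFactor β' τ < 1 := by
  obtain ⟨β', τ₁, hβ', h1, hτ₁, hlog⟩ : ∃ β' τ₁, β < β' ∧ 1 ≤ β' ∧ h₀ < τ₁ ∧
      Real.log ((β' ^ 2 + β') / (β' ^ 2 + 1)) < Real.exp (-τ₁) / β' := by
    rcases lt_or_ge β 1 with hβ | hβ
    · refine ⟨1, h₀ + 1, hβ, le_rfl, by linarith, ?_⟩
      norm_num
      positivity
    · have hc : Real.log ((β ^ 2 + β) / (β ^ 2 + 1)) < Real.exp (-h₀) / β := by
        rcases hcond with h | h
        · linarith
        · rwa [div_mul_eq_mul_div, one_mul] at h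
      have hβ0 : β ≠ 0 := by linarith
      have hne : (β ^ 2 + β) / (β ^ 2 + 1) ≠ 0 := by positivity
      have hleft : ContinuousAt (fun ε : ℝ =>
          Real.log (((β + ε) ^ 2 + (β + ε)) / ((β + ε) ^ 2 + 1))) 0 := by
        refine ContinuousAt.log (ContinuousAt.div (by fun_prop) (by fun_prop) ?_) ?_
        · positivity
        · simpa using hne
      have hright : ContinuousAt (fun ε : ℝ => Real.exp (-(h₀ + ε)) / (β + ε)) 0 :=
        ContinuousAt.div (by fun_prop) (by fun_prop) (by simpa using hβ0)
      have hev := hleft.eventually_lt hright (by simpa using hc)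
      obtain ⟨ε, hε, hε0⟩ := ((hev.filter_mono nhdsWithin_le_nhds).and
        (self_mem_nhdsWithin (s := Ioi (0 : ℝ)))).exists
      have hε0 : 0 < ε := hε0
      exact ⟨β + ε, h₀ + ε, by linarith, by linarith, by linarith, hε⟩
  have hβ0 : 0 < β' := by linarith
  set σ := Real.log ((1 + β') / β') with hσ
  have hexpσ : Real.exp σ = (1 + β') / β' := Real.exp_log (by positivity)
  have hσ0 : 0 ≤ σ := Real.log_nonneg ((one_le_div hβ0).2 (by linarith))
  refine ⟨β', max τ₁ σ, hβ', lt_max_of_lt_left hτ₁, hβ0, hσ0.trans (le_max_right _ _), ?_, ?_⟩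
  · have := mul_le_mul_of_nonneg_left (Real.exp_le_exp.2 (le_max_right τ₁ σ)) hβ0.le
    rwa [hexpσ, mul_div_cancel₀ _ hβ0.ne'] at this
  · apply contractionFactor_lt_one hβ0
    rcases max_choice τ₁ σ with h | h
    · rwa [h]
    -- at the delay `σ` the condition reads `log (1 + (β' - 1) / (β' ^ 2 + 1)) < 1 / (1 + β')`
    · rw [h, Real.exp_neg, hexpσ]
      have h2 := Real.log_le_sub_one_of_pos
        (show 0 < (β' ^ 2 + β') / (β' ^ 2 + 1) by positivity)
      refine h2.trans_lt ?_
      have h3 : (β' ^ 2 + β') / (β' ^ 2 + 1) - 1 = (β' - 1) / (β' ^ 2 + 1) := by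
        field_simp; ring
      have h4 : ((1 + β') / β')⁻¹ / β' = 1 / (1 + β') := by field_simp
      rw [h3, h4, div_lt_div_iff₀ (by positivity) (by positivity)]
      nlinarith

/-! ### The clock of the damping coefficient -/

/-- The damping coefficient, replaced by its lower bound `a₀` before time zero, where nothing is
known about it. -/
noncomputable def extendDamping (a : ℝ → ℝ) (a₀ : ℝ) : ℝ → ℝ :=
  (Ici 0).piecewise a (fun _ => a₀)

theorem extendDamping_of_nonneg {a : ℝ → ℝ} {a₀ t : ℝ} (ht : 0 ≤ t) : extendDamping a a₀ t = a t :=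
  piecewise_eq_of_mem _ _ _ ht

theorem extendDamping_of_neg {a : ℝ → ℝ} {a₀ t : ℝ} (ht : t < 0) : extendDamping a a₀ t = a₀ :=
  piecewise_eq_of_notMem (Ici 0) _ _ (not_le.2 ht)

theorem le_extendDamping {a : ℝ → ℝ} {a₀ : ℝ} (ha : ∀ t, 0 ≤ t → a₀ ≤ a t) (t : ℝ) :
    a₀ ≤ extendDamping a a₀ t := by
  rcases le_or_gt 0 t with ht | ht
  · exact (ha t ht).trans_eq (extendDamping_of_nonneg ht).symm
  · exact (extendDamping_of_neg ht).ge

theorem MeasureTheory.MemLp.exists_ae_abs_le {g : ℝ → ℝ}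
    (hg : MemLp g ⊤ (volume.restrict (Ici 0))) :
    ∃ C, 0 ≤ C ∧ ∀ᵐ t, 0 ≤ t → |g t| ≤ C := by
  refine ⟨(eLpNorm g ⊤ (volume.restrict (Ici 0))).toReal, ENNReal.toReal_nonneg, ?_⟩
  have h := ae_le_eLpNormEssSup (f := g) (μ := volume.restrict (Ici (0 : ℝ)))
  rw [ae_restrict_iff' measurableSet_Ici] at h
  filter_upwards [h] with t ht h0
  have h1 := ENNReal.toReal_mono hg.2.ne (by simpa using ht h0)
  simpa using h1

theorem locallyIntegrable_extendDamping {a : ℝ → ℝ} {a₀ : ℝ}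
    (ha : MemLp a ⊤ (volume.restrict (Ici 0))) :
    LocallyIntegrable (extendDamping a a₀) volume := by
  have h : MemLp (extendDamping a a₀) ⊤ volume :=
    MemLp.piecewise measurableSet_Ici ha (memLp_top_const a₀)
  exact h.locallyIntegrable le_top

theorem intervalIntegrable_extendDamping {a : ℝ → ℝ} {a₀ : ℝ}
    (ha : MemLp a ⊤ (volume.restrict (Ici 0))) (p q : ℝ) :
    IntervalIntegrable (extendDamping a a₀) volume p q :=
  (intervalIntegrable_iff' (by simp)).2 ((locallyIntegrable_extendDamping ha).integrableOn_isCompact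
    isCompact_uIcc)

theorem isClock_integral_extendDamping {a : ℝ → ℝ} {a₀ : ℝ}
    (ha : MemLp a ⊤ (volume.restrict (Ici 0))) (ha₀ : 0 < a₀) (ha_ge : ∀ t, 0 ≤ t → a₀ ≤ a t) :
    IsClock (extendDamping a a₀) (fun t => ∫ u in (0 : ℝ)..t, extendDamping a a₀ u) a₀ := by
  have hint := intervalIntegrable_extendDamping (a₀ := a₀) ha
  refine ⟨ha₀, fun t => ha₀.le.trans (le_extendDamping ha_ge t), ?_, ?_, ?_⟩
  · obtain ⟨C, hC0, hC⟩ := ha.exists_ae_abs_le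
    refine ⟨(C + a₀).toNNReal, LipschitzWith.of_dist_le_mul fun t s => ?_⟩
    rw [dist_eq_norm, Real.dist_eq, Real.coe_toNNReal _ (by positivity),
      intervalIntegral.integral_interval_sub_left (hint _ _) (hint _ _)]
    refine intervalIntegral.norm_integral_le_of_norm_le_const_ae ?_
    filter_upwards [hC] with u hu _
    rcases le_or_gt 0 u with h | h
    · rw [extendDamping_of_nonneg h, Real.norm_eq_abs]
      linarith [hu h]
    · rw [extendDamping_of_neg h, Real.norm_eq_abs,
        abs_of_pos ha₀]
      linarith
  · intro s t hst
    rw [intervalIntegral.integral_interval_sub_left (hint _ _) (hint _ _)]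
    have := intervalIntegral.integral_mono_on hst (f := fun _ => a₀) (by simp) (hint s t)
      (fun u _ => le_extendDamping ha_ge u)
    simpa [mul_comm] using this
  · filter_upwards [_root_.LocallyIntegrable.ae_hasDerivAt_integral
      (locallyIntegrable_extendDamping (a₀ := a₀) ha)] with t ht
    exact ht 0

/-! ### Stability of the delay equation -/

/-- The delayed arguments lie in a delay window of clock length `τ` and the gain is at most `β`
from time `T` on, so a solution is a delayed feedback there. -/
theorem IsDelaySolution.isDelayedFeedback {m : ℕ} [NeZero m] {a : ℝ → ℝ} {b h : Fin m → ℝ → ℝ}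
    {a₀ β τ T t₀ s : ℝ} {φ x : ℝ → ℝ} (hx : IsDelaySolution a b h t₀ φ x)
    (ha : MemLp a ⊤ (volume.restrict (Ici 0))) (ha₀ : 0 < a₀) (ha_ge : ∀ t, 0 ≤ t → a₀ ≤ a t)
    (hb_nonneg : ∀ k t, 0 ≤ t → 0 ≤ b k t) (hh_le : ∀ k t, 0 ≤ t → h k t ≤ t) (hT : 0 ≤ T)
    (hgain : ∀ t, T ≤ t → ∑ k, b k t ≤ β * a t)
    (hdelay : ∀ t, T ≤ t → ∫ u in (minDelay h t)..t, a u ≤ τ)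
    (hmin : ∀ t, T ≤ t → 0 ≤ minDelay h t) (ht₀s : t₀ ≤ s) (hTs : T ≤ s) :
    IsDelayedFeedback (extendDamping a a₀) (fun t => ∫ u in (0 : ℝ)..t, extendDamping a a₀ u)
      (fun t => ∑ k, b k t * x (h k t)) x β τ s := by
  have hint := intervalIntegrable_extendDamping (a₀ := a₀) ha
  have hclock := isClock_integral_extendDamping ha ha₀ ha_ge
  have hwin : ∀ u, s ≤ u → ∀ k, (∫ w in (0 : ℝ)..u, extendDamping a a₀ w) - τ ≤
      ∫ w in (0 : ℝ)..(h k u), extendDamping a a₀ w := by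
    intro u hu k
    have hTu := hTs.trans hu
    have hmk : minDelay h u ≤ h k u := Finset.inf'_le _ (Finset.mem_univ k)
    have hmu : minDelay h u ≤ u := hmk.trans (hh_le k u (hT.trans hTu))
    have h1 := hclock.strictMono.monotone hmk
    have h2 : (∫ w in (0 : ℝ)..u, extendDamping a a₀ w) -
        (∫ w in (0 : ℝ)..(minDelay h u), extendDamping a a₀ w) =
        ∫ w in (minDelay h u)..u, a w := by
      rw [intervalIntegral.integral_interval_sub_left (hint _ _) (hint _ _)]
      refine intervalIntegral.integral_congr fun w hw => ?_
      rw [uIcc_of_le hmu] at hw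
      exact extendDamping_of_nonneg ((hmin u hTu).trans hw.1)
    have h3 := hdelay u hTu
    linarith
  have hu0 : ∀ u, s ≤ u → 0 ≤ u := fun u hu => hT.trans (hTs.trans hu)
  refine ⟨fun t ht => (hx.absCont t (ht₀s.trans ht)).mono ?_, ?_, ?_, ?_⟩
  · rw [uIcc_of_le ht, uIcc_of_le (ht₀s.trans ht)]
    exact Icc_subset_Icc_left ht₀s
  · filter_upwards [hx.equation] with u hu hsu
    rw [extendDamping_of_nonneg (hu0 u hsu)]
    exact hu (ht₀s.trans hsu)
  · intro u hu c hc hlow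
    rw [extendDamping_of_nonneg (hu0 u hu)]
    have h1 : ∑ k, b k u * (-c) ≤ ∑ k, b k u * x (h k u) :=
      Finset.sum_le_sum fun k _ => mul_le_mul_of_nonneg_left
        (hlow _ (hwin u hu k) (hh_le k u (hu0 u hu))) (hb_nonneg k u (hu0 u hu))
    rw [← Finset.sum_mul] at h1
    have h2 := mul_le_mul_of_nonneg_right (hgain u (hTs.trans hu)) hc
    linarith
  · intro u hu c hc hup
    rw [extendDamping_of_nonneg (hu0 u hu)]
    have h1 : ∑ k, b k u * x (h k u) ≤ ∑ k, b k u * c :=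
      Finset.sum_le_sum fun k _ => mul_le_mul_of_nonneg_left
        (hup _ (hwin u hu k) (hh_le k u (hu0 u hu))) (hb_nonneg k u (hu0 u hu))
    rw [← Finset.sum_mul] at h1
    have h2 := mul_le_mul_of_nonneg_right (hgain u (hTs.trans hu)) hc
    linarith

/-- Solutions grow at most exponentially, at a rate independent of the initial data. -/
theorem exists_growth_rate {m : ℕ} {a : ℝ → ℝ} {b h : Fin m → ℝ → ℝ}
    (ha : MemLp a ⊤ (volume.restrict (Ici 0))) (hb : ∀ k, MemLp (b k) ⊤ (volume.restrict (Ici 0)))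
    (hh_le : ∀ k t, 0 ≤ t → h k t ≤ t) :
    ∃ C, 0 ≤ C ∧ ∀ t₀, 0 ≤ t₀ → ∀ φ x K, IsDelaySolution a b h t₀ φ x →
      (∀ v ≤ t₀, |φ v| ≤ K) → ∀ t, t₀ ≤ t → |x t| ≤ K * Real.exp (C * (t - t₀)) := by
  obtain ⟨Ca, hCa0, hCa⟩ := ha.exists_ae_abs_le
  choose Cb hCb0 hCb using fun k => (hb k).exists_ae_abs_le
  have hsum : 0 ≤ ∑ k, Cb k := Finset.sum_nonneg fun k _ => hCb0 k
  refine ⟨2 * (Ca + ∑ k, Cb k), by positivity, fun t₀ ht₀ φ x K hx hK t ht => ?_⟩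
  refine abs_le_exp_of_abs_deriv_le ((abs_nonneg _).trans (hK t₀ le_rfl)) (by positivity)
    hx.absCont ?_ (fun v hv => by rw [hx.initial v hv]; exact hK v hv) ht
  filter_upwards [hx.equation, hCa, ae_all_iff.2 hCb] with u hu hau hbu htu
  have hu0 := ht₀.trans htu
  refine ⟨_, hu htu, fun N hN => ?_⟩
  have hN0 : 0 ≤ N := (abs_nonneg _).trans (hN u le_rfl)
  rw [abs_neg]
  calc |a u * x u + ∑ k, b k u * x (h k u)|
      ≤ |a u * x u| + ∑ k, |b k u * x (h k u)| :=
        (abs_add_le _ _).trans (add_le_add le_rfl (Finset.abs_sum_le_sum_abs _ _))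
    _ ≤ Ca * N + ∑ k, Cb k * N := by
        refine add_le_add ?_ (Finset.sum_le_sum fun k _ => ?_)
        · rw [abs_mul]
          exact mul_le_mul (hau hu0) (hN u le_rfl) (abs_nonneg _) hCa0
        · rw [abs_mul]
          exact mul_le_mul (hbu k hu0) (hN _ (hh_le k u hu0)) (abs_nonneg _) (hCb0 k)
    _ = (Ca + ∑ k, Cb k) * N := by rw [← Finset.sum_mul]; ring

theorem theorem3 (m : ℕ) [NeZero m] (a : ℝ → ℝ) (b h : Fin m → ℝ → ℝ)
    (a₀ h₀ β : ℝ)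
    -- the coefficients are Lebesgue measurable and essentially bounded on `[0, ∞)`
    (ha : MeasureTheory.MemLp a ⊤ (MeasureTheory.volume.restrict (Set.Ici 0)))
    (hb : ∀ k, MeasureTheory.MemLp (b k) ⊤ (MeasureTheory.volume.restrict (Set.Ici 0)))
    -- the delayed arguments are Lebesgue measurable, `h k t ≤ t` and `h k t → ∞`
    (hh_meas : ∀ k, AEMeasurable (h k) (MeasureTheory.volume.restrict (Set.Ici 0)))
    (hh_le : ∀ k t, 0 ≤ t → h k t ≤ t)
    (hh_lim : ∀ k, Filter.Tendsto (h k) Filter.atTop Filter.atTop)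
    (ha₀ : 0 < a₀) (ha_ge : ∀ t, 0 ≤ t → a₀ ≤ a t)
    (hb_nonneg : ∀ k t, 0 ≤ t → 0 ≤ b k t)
    -- the upper limits are taken in the extended reals and are finite
    (hh₀ : Filter.limsup (fun t : ℝ => ((∫ s in (minDelay h t)..t, a s : ℝ) : EReal))
      Filter.atTop = (h₀ : EReal))
    (hβ : Filter.limsup (fun t : ℝ => (((∑ k, b k t) / a t : ℝ) : EReal))
      Filter.atTop = (β : EReal))
    -- for `β = 0` the condition is read as satisfied (the sides tend to `+∞` and `-∞`)
    (hcond : β = 0 ∨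
      1 / β * Real.exp (-h₀) > Real.log ((β ^ 2 + β) / (β ^ 2 + 1))) :
    IsExponentiallyStable a b h := by
  obtain ⟨β', τ, hβ', hτ', hβ0, hτ0, hτβ, hθ⟩ := exists_gain_delay hcond
  have hev1 := Filter.eventually_lt_of_limsup_lt
    (hβ.trans_lt (EReal.coe_lt_coe_iff.2 hβ'))
  have hev2 := Filter.eventually_lt_of_limsup_lt
    (hh₀.trans_lt (EReal.coe_lt_coe_iff.2 hτ'))
  have hev3 := Filter.eventually_all.2 fun k => (hh_lim k).eventually_ge_atTop 0
  obtain ⟨T₁, hT₁⟩ := Filter.eventually_atTop.1 (hev1.and (hev2.and hev3))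
  set T := max T₁ 0
  have hT0 : 0 ≤ T := le_max_right _ _
  have hgain : ∀ t, T ≤ t → ∑ k, b k t ≤ β' * a t := fun t ht => by
    have hat : 0 < a t := ha₀.trans_le (ha_ge t (hT0.trans ht))
    exact ((div_lt_iff₀ hat).1
      (EReal.coe_lt_coe_iff.1 (hT₁ t ((le_max_left _ _).trans ht)).1)).le
  have hdelay : ∀ t, T ≤ t → ∫ u in (minDelay h t)..t, a u ≤ τ := fun t ht =>
    (EReal.coe_lt_coe_iff.1 (hT₁ t ((le_max_left _ _).trans ht)).2.1).le
  have hmin : ∀ t, T ≤ t → 0 ≤ minDelay h t := fun t ht =>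
    Finset.le_inf' _ _ fun k _ => (hT₁ t ((le_max_left _ _).trans ht)).2.2 k
  obtain ⟨C, hC0, hC⟩ := exists_growth_rate ha hb hh_le
  have hclock := isClock_integral_extendDamping ha ha₀ ha_ge
  set θ := contractionFactor β' τ
  have hθ0 : 0 < θ := contractionFactor_pos β' τ
  have hL : 0 < 3 * τ + 1 := by positivity
  set α := -Real.log θ * a₀ / (3 * τ + 1)
  have hα : 0 < α := div_pos (mul_pos (neg_pos.2 (Real.log_neg hθ0 hθ)) ha₀) hL
  -- up to time `t₀ + D` the growth bound is used
  set D := T + (3 * τ + 1) / a₀ with hD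
  have hTD : T ≤ D := by
    have : 0 ≤ (3 * τ + 1) / a₀ := by positivity
    linarith
  refine ⟨Real.exp (C * D) * θ⁻¹ * Real.exp (α * D), α, by positivity, hα, ?_⟩
  rintro t₀ ht₀ φ - ⟨B, hB⟩ x hx t ht
  set K := ⨆ s : Iic t₀, |φ s|
  have hK : ∀ v ≤ t₀, |φ v| ≤ K := fun v hv =>
    le_ciSup (f := fun s : Iic t₀ => |φ s|)
      ⟨B, by rintro _ ⟨s, rfl⟩; exact hB s s.2⟩ ⟨v, hv⟩
  have hK0 : 0 ≤ K := (abs_nonneg _).trans (hK t₀ le_rfl)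
  have hgrow : ∀ v, t₀ ≤ v → v ≤ t₀ + D → |x v| ≤ K * Real.exp (C * D) := fun v hv hvD =>
    (hC t₀ ht₀ φ x K hx hK v hv).trans (mul_le_mul_of_nonneg_left
      (Real.exp_le_exp.2 (mul_le_mul_of_nonneg_left (by linarith) hC0)) hK0)
  set s := max t₀ T
  have hsT : s ≤ t₀ + T := max_le (by linarith) (by linarith)
  have hexp : ∀ w, t - t₀ ≤ w + D →
      Real.exp (-α * w) ≤ Real.exp (α * D) * Real.exp (-α * (t - t₀)) := fun w hw => by
    rw [← Real.exp_add]
    apply Real.exp_le_exp.2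
    nlinarith
  rcases le_total s t with hst | hst
  · have hfb := hx.isDelayedFeedback ha ha₀ ha_ge hb_nonneg hh_le hT0 hgain hdelay hmin
      (le_max_left t₀ T) (le_max_right t₀ T)
    have h1 := hfb.abs_le_exp hclock hβ0 hτβ hτ0 hθ (c := K * Real.exp (C * D)) (by
      intro v hsv hAv
      refine hgrow v ((le_max_left _ _).trans hsv) ?_
      have h2 := hclock.growth s v hsv
      have h3 : v - s ≤ (3 * τ + 1) / a₀ := by
        rw [le_div_iff₀ ha₀]
        linarith
      linarith) hst
    refine h1.trans ?_
    have h2 := mul_le_mul_of_nonneg_left (hexp (t - s) (by linarith))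
      (show 0 ≤ K * Real.exp (C * D) * θ⁻¹ by positivity)
    refine h2.trans (le_of_eq ?_)
    ring
  · have h1 := hgrow t ht (by linarith)
    have h2 : (1 : ℝ) ≤ Real.exp (α * D) * Real.exp (-α * (t - t₀)) := by
      simpa using hexp 0 (by linarith)
    have h3 : 1 ≤ θ⁻¹ := (one_le_inv₀ hθ0).2 hθ.le
    have h4 : 1 ≤ θ⁻¹ * (Real.exp (α * D) * Real.exp (-α * (t - t₀))) :=
      one_le_mul_of_one_le_of_one_le h3 h2
    calc |x t| ≤ K * Real.exp (C * D) := h1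
      _ ≤ K * Real.exp (C * D) * (θ⁻¹ * (Real.exp (α * D) * Real.exp (-α * (t - t₀)))) :=
        le_mul_of_one_le_right (by positivity) h4
      _ = _ := by ring
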